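/- **Theorem 2.1.** Let $T$ be a real-valued random variable with $\mathbb P(T=0)\neq 1$, and let $(T_n)_{n\ge 0}$ be the random walk $T_0=0$, $T_n=X_0+\dots+X_{n-1}$, where $X_0,X_1,\dots$ are independent with the same distribution as $T$. Put $\psi(t)=\mathbb E e^{-tT}\in(0,\infty]$ for $t\ge 0$, and $R=-\log\inf_{t\ge 0}\psi(t)\in[0,\infty]$ (with $-\log 0=\infty$). Let $\psi'$ denote the left derivative of $\psi$. Fix $a>0$ and let $$V(x)=\sum_{n\ge 0}e^{an}\,\mathbb P(T_n\le x)\in[0,\infty],\qquad x\in\mathbb R.$$ (a) Assume $\mathbb P(T<0)>0$. Then there is a unique $\gamma_0\in[0,\infty)$ with $\psi(\gamma_0)=e^{-R}$. Moreover: (i) If $a<R$, then $V(x)<\infty$ for every $x\in\mathbb R$. If $a=R$ (so that $R>0$), then $\gamma_0>0$, $\psi$ is finite on $[0,\gamma_0]$, the left derivative $\psi'(\gamma_0)$ exists and is finite, $e^{-\gamma_0T}T$ is integrable, and $-\psi'(\gamma_0)=\mathbb E\, e^{-\gamma_0T}T\ge 0$. In this case: (ii) If $a=R$ and $-\psi'(\gamma_0)>0$,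 then $V(x)<\infty$ for every $x\in\mathbb R$. (iii) If $a>R$, then $V(x)=\infty$ for every $x\in\mathbb R$. (iv) If $a=R$ and $\psi'(\gamma_0)=0$ (equivalently, $-\psi'(\gamma_0)>0$ fails), then $V(x)=\infty$ for every $x\in\mathbb R$. (b) Assume $\mathbb P(T>0)=1$. Then $V(x)<\infty$ for every $x\in\mathbb R$. (c) Assume $\mathbb P(T\ge 0)=1$ and $\beta:=\mathbb P(T=0)>0$. Then $R=-\log\beta$. If $a<R$, then $V(x)<\infty$ for every $x\in\mathbb R$; if $a\ge R$, then $V(x)=\infty$ for every $x\ge 0$. -/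

import Mathlib

open MeasureTheory ProbabilityTheory Set
open scoped ENNReal

noncomputable section

namespace ExpRenewal

/-- The Laplace transform `ψ(t) = E e^{-tT}`, with values in `[0, ∞]`. -/
def laplace {Ω : Type*} [MeasurableSpace Ω] (Q : Measure Ω) (T : Ω → ℝ) (t : ℝ) : ℝ≥0∞ :=
  ∫⁻ ω, ENNReal.ofReal (Real.exp (-(t * T ω))) ∂Q

/-- `R = -log inf_{t ≥ 0} ψ(t)`, with values in `[-∞, ∞]` (so `R = ∞` when the infimum is `0`). -/
def expRate {Ω : Type*} [MeasurableSpace Ω] (Q : Measure Ω) (T : Ω → ℝ) : EReal :=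
  -ENNReal.log (⨅ t ∈ Ici (0 : ℝ), laplace Q T t)

/-- The left derivative at `t` of the Laplace transform. It is only meaningful where `ψ` is finite
on a left neighbourhood of `t` and left differentiable at `t`. -/
def laplaceLeftDeriv {Ω : Type*} [MeasurableSpace Ω] (Q : Measure Ω) (T : Ω → ℝ) (t : ℝ) : ℝ :=
  derivWithin (fun s => (laplace Q T s).toReal) (Iic t) t

/-- The zero-delayed random walk `T_n = X_0 + ⋯ + X_{n-1}` with steps `X_0, X_1, …`. -/
def walk {Ω : Type*} (X : ℕ → Ω → ℝ) (n : ℕ) (ω : Ω) : ℝ :=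
  ∑ i ∈ Finset.range n, X i ω

/-- The exponential renewal function `V(x) = ∑_{n ≥ 0} e^{an} P(T_n ≤ x)`, with values in
`[0, ∞]`. -/
def expRenewal {Ω : Type*} [MeasurableSpace Ω] (P : Measure Ω) (X : ℕ → Ω → ℝ) (a x : ℝ) : ℝ≥0∞ :=
  ∑' n : ℕ, ENNReal.ofReal (Real.exp (a * n)) * P {ω | walk X n ω ≤ x}

end ExpRenewal

end

namespace ExpRenewal

open Filter Topology

/-! Tilting the step law by `e^{-γx}/ψ(γ)` gives `renew_tilt`: the `n`-th term of `V(x)` is `(e^a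
ψ(γ))^n` times the integral of `e^{γs}` over `s ≤ x` against the law of the tilted walk. If `e^a
ψ(γ) < 1` for some `γ ≥ 0`, the series is dominated by a geometric one (`renew_lt_top_of_lap_lt`);
this covers every case `a < R`, and strictly positive steps, where `inf ψ = 0`.

At `a = R` the choice `γ = γ₀` makes the ratio `1`, so `V(x)` integrates `e^{γ₀s}` against the
renewal measure of a walk whose drift is a positive multiple of `-ψ'(γ₀)`. Positive drift means
transience, hence a renewal measure bounded uniformly on unit intervals
(`exists_renewalMeasure_Icc_le`), and `V` is finite. Zero drift means recurrence
(`not_eventually_one_lt_abs_of_centred`), and `V` is infinite.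

For `a > R` with negative steps possible, suppose `V` is finite. It is positive, increasing and
satisfies `e^a E V(x - T) ≤ V(x)`. Averaging the increments of `log V` over long stretches produces
a linear function; by Jensen and Fatou its exponential is superharmonic up to a factor close to `1`
(`exists_lap_le_of_superharmonic`). Hence `inf ψ ≤ e^{-a}`, a contradiction. For nonnegative steps
with an atom at `0`, staying at `0` already makes every term at least `1` when `a ≥ R`. -/

/-! ### Convolution powers and exponential change of measure. -/

/-- The `n`-fold convolution power of a measure on `ℝ`. -/
noncomputable def iterConv (μ : Measure ℝ) : ℕ → Measure ℝ
  | 0 => Measure.dirac 0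
  | n + 1 => (iterConv μ n).conv μ

/-- The Laplace transform of a measure on `ℝ`. -/
noncomputable def lap (μ : Measure ℝ) (t : ℝ) : ℝ≥0∞ :=
  ∫⁻ x, ENNReal.ofReal (Real.exp (-(t * x))) ∂μ

/-- The exponential renewal function of a step distribution on `ℝ`. -/
noncomputable def renew (μ : Measure ℝ) (a x : ℝ) : ℝ≥0∞ :=
  ∑' n : ℕ, ENNReal.ofReal (Real.exp (a * n)) * iterConv μ n (Iic x)

/-- The exponentially tilted probability measure `ψ(γ)⁻¹ e^{-γx} μ(dx)`. -/
noncomputable def tilt (μ : Measure ℝ) (γ : ℝ) : Measure ℝ :=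
  (lap μ γ)⁻¹ • μ.withDensity fun x => ENNReal.ofReal (Real.exp (-(γ * x)))

instance iterConv_isProbabilityMeasure (μ : Measure ℝ) [IsProbabilityMeasure μ] (n : ℕ) :
    IsProbabilityMeasure (iterConv μ n) := by
  induction n with
  | zero => unfold iterConv; infer_instance
  | succ n ih => unfold iterConv; infer_instance

theorem lintegral_iterConv_succ (μ : Measure ℝ) [IsProbabilityMeasure μ] (n : ℕ) {g : ℝ → ℝ≥0∞}
    (hg : Measurable g) :
    ∫⁻ x, g x ∂(iterConv μ (n + 1)) = ∫⁻ s, ∫⁻ t, g (s + t) ∂μ ∂(iterConv μ n) :=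
  Measure.lintegral_conv hg

theorem iterConv_add (μ : Measure ℝ) [IsProbabilityMeasure μ] (m n : ℕ) :
    iterConv μ (m + n) = (iterConv μ m).conv (iterConv μ n) := by
  induction n with
  | zero => simp [iterConv]
  | succ n ih => rw [← add_assoc, iterConv, ih, Measure.conv_assoc, iterConv]

theorem map_walk {Ω : Type*} [MeasurableSpace Ω] {P : Measure Ω} [IsProbabilityMeasure P]
    {X : ℕ → Ω → ℝ} {μ : Measure ℝ} (hX : ∀ i, AEMeasurable (X i) P) (hindep : iIndepFun X P)
    (hμ : ∀ i, P.map (X i) = μ) (n : ℕ) : P.map (walk X n) = iterConv μ n := by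
  have key : ∀ n, walk X n = ∑ i ∈ Finset.range n, X i := fun n => by ext; simp [walk]
  induction n with
  | zero =>
    have : walk X 0 = fun _ => 0 := by ext; simp [walk]
    rw [this, Measure.map_const, measure_univ, one_smul, iterConv]
  | succ n ih =>
    rw [key, Finset.sum_range_succ, iterConv, ← ih, ← hμ n, key]
    exact (hindep.indepFun_sum_range_succ₀ hX n).map_add_eq_map_conv_map₀
      (Finset.aemeasurable_sum _ fun i _ => hX i) (hX n)

theorem aemeasurable_walk {Ω : Type*} [MeasurableSpace Ω] {P : Measure Ω}
    {X : ℕ → Ω → ℝ} (hX : ∀ i, AEMeasurable (X i) P) (n : ℕ) : AEMeasurable (walk X n) P :=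
  Finset.aemeasurable_fun_sum _ fun i _ => hX i

theorem lintegral_tilt {μ : Measure ℝ} {γ : ℝ} {g : ℝ → ℝ≥0∞} (hg : Measurable g) :
    ∫⁻ x, g x ∂(tilt μ γ) =
      (lap μ γ)⁻¹ * ∫⁻ x, ENNReal.ofReal (Real.exp (-(γ * x))) * g x ∂μ := by
  rw [tilt, lintegral_smul_measure, lintegral_withDensity_eq_lintegral_mul _ (by fun_prop) hg]
  simp

theorem lap_ne_zero (μ : Measure ℝ) [NeZero μ] (t : ℝ) : lap μ t ≠ 0 := by
  rw [lap, Ne, lintegral_eq_zero_iff (by fun_prop)]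
  intro h
  have : ∀ᵐ x ∂μ, False := by
    filter_upwards [h] with x hx
    simp at hx
    linarith [Real.exp_pos (-(t * x))]
  simp at this
  exact NeZero.ne μ this

theorem tilt_isProbabilityMeasure {μ : Measure ℝ} [NeZero μ] {γ : ℝ} (h : lap μ γ ≠ ∞) :
    IsProbabilityMeasure (tilt μ γ) := by
  constructor
  have := lintegral_tilt (μ := μ) (γ := γ) (g := fun _ => 1) measurable_const
  simp only [lintegral_const, one_mul, mul_one] at this
  rw [this]
  exact ENNReal.inv_mul_cancel (lap_ne_zero μ γ) h

/-- Change of measure: the law of the walk in terms of the tilted walk. -/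
theorem lintegral_iterConv_tilt {μ : Measure ℝ} [IsProbabilityMeasure μ] {γ : ℝ}
    (h : lap μ γ ≠ ∞) (n : ℕ) {g : ℝ → ℝ≥0∞} (hg : Measurable g) :
    ∫⁻ x, g x ∂(iterConv μ n) = lap μ γ ^ n *
      ∫⁻ x, ENNReal.ofReal (Real.exp (γ * x)) * g x ∂(iterConv (tilt μ γ) n) := by
  have := tilt_isProbabilityMeasure h
  induction n generalizing g with
  | zero => simp [iterConv]
  | succ n ih =>
    rw [lintegral_iterConv_succ _ _ hg, ih (by fun_prop), lintegral_iterConv_succ _ _ (by fun_prop),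
      pow_succ, mul_assoc]
    congr 1
    rw [← lintegral_const_mul _ (by fun_prop)]
    refine lintegral_congr fun s => ?_
    rw [lintegral_tilt (by fun_prop), ← mul_assoc, ENNReal.mul_inv_cancel (lap_ne_zero μ γ) h,
      one_mul, ← lintegral_const_mul _ (by fun_prop)]
    refine lintegral_congr fun t => ?_
    rw [← mul_assoc, ← ENNReal.ofReal_mul (Real.exp_pos _).le, ← Real.exp_add]
    ring_nf

theorem renew_tilt {μ : Measure ℝ} [IsProbabilityMeasure μ] {γ : ℝ} (h : lap μ γ ≠ ∞) (a x : ℝ) :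
    renew μ a x = ∑' n : ℕ, (ENNReal.ofReal (Real.exp a) * lap μ γ) ^ n *
      ∫⁻ s in Iic x, ENNReal.ofReal (Real.exp (γ * s)) ∂(iterConv (tilt μ γ) n) := by
  refine tsum_congr fun n => ?_
  rw [← lintegral_indicator_one measurableSet_Iic,
    lintegral_iterConv_tilt h n (measurable_one.indicator measurableSet_Iic), mul_pow,
    ← lintegral_indicator measurableSet_Iic, ← ENNReal.ofReal_pow (Real.exp_pos _).le,
    ← Real.exp_nat_mul, mul_comm a, mul_assoc]
  congr! 4 with s
  simp [indicator]

/-- The hypothesis says that the geometric ratio in `renew_tilt` is below `1`; since `γ ≥ 0`, the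
remaining integrals are at most `e^{γx}`. -/
theorem renew_lt_top_of_lap_lt {μ : Measure ℝ} [IsProbabilityMeasure μ] {γ a : ℝ} (hγ : 0 ≤ γ)
    (h : lap μ γ < ENNReal.ofReal (Real.exp (-a))) (x : ℝ) : renew μ a x < ∞ := by
  have hfin : lap μ γ ≠ ∞ := (h.trans_le le_top).ne
  have := tilt_isProbabilityMeasure hfin
  rw [renew_tilt hfin]
  have hr : ENNReal.ofReal (Real.exp a) * lap μ γ < 1 := by
    calc _ < ENNReal.ofReal (Real.exp a) * ENNReal.ofReal (Real.exp (-a)) := by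
          refine ENNReal.mul_lt_mul_right (by simp [Real.exp_pos]) (by simp) h
      _ = 1 := by rw [← ENNReal.ofReal_mul (Real.exp_pos _).le, ← Real.exp_add]; simp
  calc _ ≤ ∑' n : ℕ, (ENNReal.ofReal (Real.exp a) * lap μ γ) ^ n
        * ENNReal.ofReal (Real.exp (γ * x)) := by
        refine ENNReal.tsum_le_tsum fun n => ?_
        gcongr
        calc _ ≤ ∫⁻ s in Iic x, ENNReal.ofReal (Real.exp (γ * x)) ∂(iterConv (tilt μ γ) n) := by
              refine setLIntegral_mono measurable_const fun s hs => ?_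
              gcongr
              exact hs
          _ ≤ _ := by
              rw [setLIntegral_const]
              exact mul_le_of_le_one_right' prob_le_one
    _ < ∞ := by
        rw [ENNReal.tsum_mul_right, ENNReal.tsum_geometric]
        exact ENNReal.mul_lt_top (by simpa using hr) (by simp)

theorem expRenewal_eq_renew {Ω : Type*} [MeasurableSpace Ω] {P : Measure Ω}
    [IsProbabilityMeasure P]
    {X : ℕ → Ω → ℝ} {μ : Measure ℝ} (hX : ∀ i, AEMeasurable (X i) P) (hindep : iIndepFun X P)
    (hμ : ∀ i, P.map (X i) = μ) (a x : ℝ) : expRenewal P X a x = renew μ a x := by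
  refine tsum_congr fun n => ?_
  rw [← map_walk hX hindep hμ, Measure.map_apply_of_aemeasurable (aemeasurable_walk hX n)
    measurableSet_Iic]
  rfl

theorem laplace_eq_lap {Ω : Type*} [MeasurableSpace Ω] {Q : Measure Ω} {T : Ω → ℝ}
    (hT : AEMeasurable T Q) (t : ℝ) : laplace Q T t = lap (Q.map T) t := by
  rw [lap, lintegral_map' (by fun_prop) hT]
  rfl

/-! ### Existence and uniqueness of the minimiser of the Laplace transform. -/

/-- Fatou. Only lower semicontinuity can be expected, since the transform may jump to `∞`. -/
theorem lap_le_liminf (μ : Measure ℝ) {u : ℕ → ℝ} {t : ℝ} (hu : Tendsto u atTop (𝓝 t)) :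
    lap μ t ≤ liminf (fun n => lap μ (u n)) atTop := by
  refine le_trans (lintegral_mono fun x => ?_) (lintegral_liminf_le fun n => by fun_prop)
  have : Tendsto (fun n => ENNReal.ofReal (Real.exp (-(u n * x)))) atTop
      (𝓝 (ENNReal.ofReal (Real.exp (-(t * x))))) :=
    ENNReal.tendsto_ofReal ((Real.continuous_exp.tendsto _).comp (hu.mul_const x).neg)
  exact this.liminf_eq.ge

theorem lap_zero (μ : Measure ℝ) [IsProbabilityMeasure μ] : lap μ 0 = 1 := by
  simp [lap]

theorem exists_pos_measure_Iic_neg {μ : Measure ℝ} (h : 0 < μ (Iio 0)) :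
    ∃ ε > 0, 0 < μ (Iic (-ε)) := by
  by_contra! hc
  have : Iio (0 : ℝ) ⊆ ⋃ n : ℕ, Iic (-(1 / ((n : ℝ) + 1))) := by
    intro x hx
    obtain ⟨n, hn⟩ := exists_nat_one_div_lt (show (0 : ℝ) < -x from neg_pos.2 hx)
    exact mem_iUnion.2 ⟨n, by simp only [mem_Iic]; linarith⟩
  have h0 : μ (⋃ n : ℕ, Iic (-(1 / ((n : ℝ) + 1)))) = 0 :=
    measure_iUnion_null fun n => le_antisymm (hc _ (by positivity)) zero_le
  exact h.ne' (measure_mono_null this h0)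

theorem le_lap_of_neg (μ : Measure ℝ) {ε t : ℝ} (ht : 0 ≤ t) :
    ENNReal.ofReal (Real.exp (t * ε)) * μ (Iic (-ε)) ≤ lap μ t := by
  rw [← setLIntegral_const]
  refine (setLIntegral_mono (by fun_prop) fun x hx => ?_).trans (setLIntegral_le_lintegral _ _)
  gcongr
  simp only [mem_Iic] at hx
  nlinarith

/-- Mass on the negative axis makes the transform grow exponentially by `le_lap_of_neg`, so a
minimising sequence stays in a compact interval; semicontinuity does the rest. -/
theorem exists_lap_eq_iInf {μ : Measure ℝ} [IsProbabilityMeasure μ] (h : 0 < μ (Iio 0)) :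
    ∃ γ : ℝ, 0 ≤ γ ∧ lap μ γ = ⨅ t ∈ Ici (0 : ℝ), lap μ t := by
  obtain ⟨ε, hε, hp⟩ := exists_pos_measure_Iic_neg h
  set I := ⨅ t ∈ Ici (0 : ℝ), lap μ t with hI
  have hIle : ∀ t, 0 ≤ t → I ≤ lap μ t := fun t ht => iInf₂_le t ht
  have hI' : I = sInf (lap μ '' Ici 0) := by rw [sInf_image]
  obtain ⟨v, -, hv, hvmem⟩ := exists_seq_tendsto_sInf (S := lap μ '' Ici 0)
    ⟨_, mem_image_of_mem _ (mem_Ici.2 le_rfl)⟩ (OrderBot.bddBelow _)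
  rw [← hI'] at hv
  choose u hu0 huv using hvmem
  have hI1 : I < 2 := ((hIle 0 le_rfl).trans (lap_zero μ).le).trans_lt (by norm_num)
  have hM : Tendsto (fun t : ℝ => ENNReal.ofReal (Real.exp (t * ε)) * μ (Iic (-ε))) atTop
      (𝓝 (∞ * μ (Iic (-ε)))) := by
    refine ENNReal.Tendsto.mul_const ?_ (Or.inl (by simp))
    exact ENNReal.tendsto_ofReal_atTop.comp
      (Real.tendsto_exp_atTop.comp (tendsto_id.atTop_mul_const hε))
  rw [ENNReal.top_mul hp.ne'] at hM
  obtain ⟨M, hM⟩ := (eventually_atTop.1 (hM.eventually (lt_mem_nhds (ENNReal.ofNat_lt_top (n := 2)))))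
  have hev : ∀ᶠ n in atTop, u n ∈ Icc 0 M := by
    filter_upwards [hv.eventually (gt_mem_nhds hI1)] with n hn
    refine ⟨hu0 n, ?_⟩
    by_contra! hc
    have := (hM _ hc.le).trans_le (le_lap_of_neg μ (hu0 n))
    rw [huv] at this
    exact absurd hn (not_lt.2 this.le)
  obtain ⟨γ, hγ, φ, hφ, hlim⟩ := isCompact_Icc.tendsto_subseq' hev.frequently
  refine ⟨γ, hγ.1, le_antisymm ((lap_le_liminf μ hlim).trans ?_) (hIle _ hγ.1)⟩
  simp only [Function.comp_apply, huv]
  exact (hv.comp hφ.tendsto_atTop).liminf_eq.le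

/-- Strict convexity at the midpoint, in exact form: the defect is the integral of `(e^{-sx/2} -
e^{-tx/2})²`, which vanishes only if `s = t` or the law sits at `0`. -/
theorem lap_minimizer_unique {μ : Measure ℝ} (hnd : ¬ ∀ᵐ x ∂μ, x = 0) {s t : ℝ}
    (hst : lap μ s = lap μ t) (hfin : lap μ s ≠ ∞) (hmin : lap μ s ≤ lap μ ((s + t) / 2)) :
    s = t := by
  by_contra hne
  have hsum : lap μ s + lap μ t = 2 * lap μ ((s + t) / 2) +
      ∫⁻ x, ENNReal.ofReal ((Real.exp (-(s * x / 2)) - Real.exp (-(t * x / 2))) ^ 2) ∂μ := by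
    simp only [lap]
    rw [← lintegral_const_mul _ (by fun_prop), ← lintegral_add_left (by fun_prop),
      ← lintegral_add_left (by fun_prop)]
    refine lintegral_congr fun x => ?_
    rw [← ENNReal.ofReal_add (by positivity) (by positivity),
      show (2 : ℝ≥0∞) = ENNReal.ofReal 2 by simp, ← ENNReal.ofReal_mul (by positivity),
      ← ENNReal.ofReal_add (by positivity) (by positivity)]
    congr 1
    have h1 : Real.exp (-(s * x)) = Real.exp (-(s * x / 2)) ^ 2 := by
      rw [← Real.exp_nat_mul]; congr 1; push_cast; ring
    have h2 : Real.exp (-(t * x)) = Real.exp (-(t * x / 2)) ^ 2 := by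
      rw [← Real.exp_nat_mul]; congr 1; push_cast; ring
    have h3 : Real.exp (-((s + t) / 2 * x)) = Real.exp (-(s * x / 2)) * Real.exp (-(t * x / 2)) := by
      rw [← Real.exp_add]; congr 1; ring
    rw [h1, h2, h3]
    ring
  rw [← hst, ← two_mul] at hsum
  have hD : ∫⁻ x, ENNReal.ofReal ((Real.exp (-(s * x / 2)) - Real.exp (-(t * x / 2))) ^ 2) ∂μ = 0 := by
    have h2 : 2 * lap μ s + ∫⁻ x, ENNReal.ofReal
        ((Real.exp (-(s * x / 2)) - Real.exp (-(t * x / 2))) ^ 2) ∂μ ≤ 2 * lap μ s + 0 := by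
      rw [add_zero]
      nth_rewrite 2 [hsum]
      gcongr
    exact le_antisymm ((ENNReal.add_le_add_iff_left (by finiteness)).1 h2) zero_le
  rw [lintegral_eq_zero_iff (by fun_prop)] at hD
  refine hnd ?_
  filter_upwards [hD] with x hx
  simp only [Pi.zero_apply, ENNReal.ofReal_eq_zero] at hx
  have := pow_eq_zero_iff (two_ne_zero) |>.1 (le_antisymm hx (sq_nonneg _))
  have := Real.exp_injective (sub_eq_zero.1 this)
  have : (s - t) * x = 0 := by linarith
  exact (mul_eq_zero.1 this).resolve_left (sub_ne_zero.2 hne)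

/-! ### The left derivative at the minimiser. -/

theorem lap_lt_top_of_mem_Icc {μ : Measure ℝ} [IsProbabilityMeasure μ] {γ t : ℝ}
    (h : lap μ γ ≠ ∞) (ht : t ∈ Icc 0 γ) : lap μ t < ∞ := by
  calc lap μ t ≤ ∫⁻ x, 1 + ENNReal.ofReal (Real.exp (-(γ * x))) ∂μ := by
        refine lintegral_mono fun x => ?_
        rw [← ENNReal.ofReal_one, ← ENNReal.ofReal_add zero_le_one (by positivity)]
        gcongr
        rcases le_total 0 x with hx | hx
        · have : Real.exp (-(t * x)) ≤ 1 := Real.exp_le_one_iff.2 (by nlinarith [ht.1])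
          linarith [Real.exp_pos (-(γ * x))]
        · have : Real.exp (-(t * x)) ≤ Real.exp (-(γ * x)) :=
            Real.exp_le_exp.2 (by nlinarith [ht.2])
          linarith
    _ < ∞ := by
        rw [lintegral_add_left (by fun_prop)]
        simp only [lintegral_const, measure_univ]
        exact ENNReal.add_lt_top.2 ⟨by simp, h.lt_top⟩

theorem integrable_exp_of_lap {μ : Measure ℝ} {t : ℝ} (h : lap μ t ≠ ∞) :
    Integrable (fun x => Real.exp (-(t * x))) μ :=
  lintegral_ofReal_ne_top_iff_integrable (by fun_prop)
    (Eventually.of_forall fun x => (Real.exp_pos _).le) |>.1 h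

theorem toReal_lap (μ : Measure ℝ) (t : ℝ) :
    (lap μ t).toReal = ∫ x, Real.exp (-(t * x)) ∂μ :=
  (integral_eq_lintegral_of_nonneg_ae (Eventually.of_forall fun x => (Real.exp_pos _).le)
    (by fun_prop)).symm

/-- The difference quotient of `t ↦ e^{-tx}` on `[s, γ]`, with a minus sign. -/
noncomputable def expSlope (γ s x : ℝ) : ℝ :=
  (γ - s)⁻¹ * (Real.exp (-(s * x)) - Real.exp (-(γ * x)))

theorem le_expSlope {γ s : ℝ} (hs : s < γ) (x : ℝ) : Real.exp (-(γ * x)) * x ≤ expSlope γ s x := by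
  rw [expSlope, inv_mul_eq_div, le_div_iff₀ (sub_pos.2 hs)]
  have : Real.exp (-(s * x)) = Real.exp (-(γ * x)) * Real.exp ((γ - s) * x) := by
    rw [← Real.exp_add]; ring_nf
  rw [this]
  nlinarith [Real.add_one_le_exp ((γ - s) * x), Real.exp_pos (-(γ * x))]

/-- Convexity of `exp`: secant slopes are monotone. With `le_expSlope` this traps the quotients
between the tangent at `γ` and the chord from `0`. -/
theorem expSlope_le {γ s : ℝ} (h0 : 0 ≤ s) (hs : s < γ) (x : ℝ) :
    expSlope γ s x ≤ expSlope γ 0 x := by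
  have hγ : 0 < γ := h0.trans_lt hs
  have hconv := convexOn_exp.2 (mem_univ 0) (mem_univ (-(γ * x)))
    (sub_nonneg.2 ((div_le_one hγ).2 hs.le)) (div_nonneg h0 hγ.le) (by ring)
  have : s / γ * (-(γ * x)) = -(s * x) := by field_simp
  simp only [smul_eq_mul, mul_zero, zero_add, Real.exp_zero, mul_one, this] at hconv
  rw [expSlope, expSlope, inv_mul_eq_div, inv_mul_eq_div, div_le_div_iff₀ (by linarith) (by linarith)]
  have h2 : s / γ * γ = s := by field_simp
  simp only [sub_zero, zero_mul, neg_zero, Real.exp_zero]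
  have := mul_le_mul_of_nonneg_right hconv hγ.le
  have h3 : (1 - s / γ + s / γ * Real.exp (-(γ * x))) * γ = γ - s + s * Real.exp (-(γ * x)) := by
    field_simp
  rw [h3] at this
  nlinarith

theorem tendsto_expSlope (γ x : ℝ) :
    Tendsto (fun s => expSlope γ s x) (𝓝[<] γ) (𝓝 (Real.exp (-(γ * x)) * x)) := by
  have hd : HasDerivAt (fun s : ℝ => Real.exp (-(s * x))) (Real.exp (-(γ * x)) * (-(1 * x))) γ :=
    ((hasDerivAt_id γ).mul_const x).neg.exp
  have := (hasDerivWithinAt_iff_tendsto_slope' (notMem_Iio.2 le_rfl)).1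
    (hd.hasDerivWithinAt (s := Iio γ))
  refine (this.neg.congr fun s => ?_).trans_eq ?_
  · rw [slope_def_field, expSlope, inv_mul_eq_div, ← neg_sub γ s, div_neg, neg_neg]
  · congr 1; ring

/-- The transform may be infinite to the right of `γ`, so integrability has to come from minimality:
all quotients `expSlope γ s` have nonnegative integral, and Fatou applied to `expSlope γ 0 -
expSlope γ s` as `s ↑ γ` bounds the limit by the integral of `expSlope γ 0`. -/
theorem integrable_of_minimizer {μ : Measure ℝ} [IsProbabilityMeasure μ] {γ : ℝ} (hγ : 0 < γ)
    (h : lap μ γ ≠ ∞) (hmin : ∀ t, 0 ≤ t → lap μ γ ≤ lap μ t) :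
    Integrable (fun x => Real.exp (-(γ * x)) * x) μ := by
  have hint : ∀ s ∈ Ico 0 γ, Integrable (expSlope γ s) μ := fun s hs =>
    ((integrable_exp_of_lap (lap_lt_top_of_mem_Icc h ⟨hs.1, hs.2.le⟩).ne).sub
      (integrable_exp_of_lap h)).const_mul _
  have hnn : ∀ s ∈ Ico 0 γ, 0 ≤ ∫ x, expSlope γ s x ∂μ := by
    intro s hs
    unfold expSlope
    have hsf := (lap_lt_top_of_mem_Icc h ⟨hs.1, hs.2.le⟩).ne
    rw [integral_const_mul, integral_sub (integrable_exp_of_lap hsf) (integrable_exp_of_lap h),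
      ← toReal_lap, ← toReal_lap]
    have := ENNReal.toReal_mono hsf (hmin s hs.1)
    exact mul_nonneg (inv_nonneg.2 (sub_nonneg.2 hs.2.le)) (by linarith)
  obtain ⟨u, -, hu, hlim⟩ := exists_seq_strictMono_tendsto' hγ
  have hlim' : Tendsto u atTop (𝓝[<] γ) :=
    tendsto_nhdsWithin_iff.2 ⟨hlim, Eventually.of_forall fun n => (hu n).2⟩
  have hmem : ∀ n, u n ∈ Ico 0 γ := fun n => ⟨(hu n).1.le, (hu n).2⟩
  have h0 : (0 : ℝ) ∈ Ico 0 γ := ⟨le_rfl, hγ⟩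
  have key : Integrable (fun x => expSlope γ 0 x - Real.exp (-(γ * x)) * x) μ := by
    refine lintegral_ofReal_ne_top_iff_integrable (by unfold expSlope; fun_prop)
      (Eventually.of_forall fun x => sub_nonneg.2 (le_expSlope hγ x)) |>.1 ?_
    refine ne_top_of_le_ne_top (b := ENNReal.ofReal (∫ x, expSlope γ 0 x ∂μ)) (by simp) ?_
    calc _ ≤ ∫⁻ x, liminf (fun n => ENNReal.ofReal (expSlope γ 0 x - expSlope γ (u n) x)) atTop ∂μ := by
          refine lintegral_mono fun x => ?_
          exact (ENNReal.tendsto_ofReal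
            (tendsto_const_nhds.sub ((tendsto_expSlope γ x).comp hlim'))).liminf_eq.ge
      _ ≤ liminf (fun n => ∫⁻ x, ENNReal.ofReal (expSlope γ 0 x - expSlope γ (u n) x) ∂μ) atTop :=
          lintegral_liminf_le fun n => by unfold expSlope; fun_prop
      _ ≤ _ := by
          refine liminf_le_of_le (by isBoundedDefault) fun b hb => ?_
          obtain ⟨n, hn⟩ := hb.exists
          refine hn.trans ?_
          rw [← ofReal_integral_eq_lintegral_ofReal
            (f := fun x => expSlope γ 0 x - expSlope γ (u n) x)
            ((hint 0 h0).sub (hint _ (hmem n))) (Eventually.of_forall fun x => sub_nonneg.2 (expSlope_le (hmem n).1 (hmem n).2 x)),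
            integral_sub (hint 0 h0) (hint _ (hmem n))]
          gcongr
          linarith [hnn _ (hmem n)]
  have := (hint 0 h0).sub key
  refine this.congr (Eventually.of_forall fun x => ?_)
  simp

theorem hasDerivWithinAt_lap {μ : Measure ℝ} [IsProbabilityMeasure μ] {γ : ℝ} (hγ : 0 < γ)
    (h : lap μ γ ≠ ∞) (hI : Integrable (fun x => Real.exp (-(γ * x)) * x) μ) :
    HasDerivWithinAt (fun s => (lap μ s).toReal) (-∫ x, Real.exp (-(γ * x)) * x ∂μ) (Iic γ) γ := by
  have hint : ∀ s ∈ Ico 0 γ, Integrable (expSlope γ s) μ := fun s hs =>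
    ((integrable_exp_of_lap (lap_lt_top_of_mem_Icc h ⟨hs.1, hs.2.le⟩).ne).sub
      (integrable_exp_of_lap h)).const_mul _
  rw [hasDerivWithinAt_iff_tendsto_slope]
  have hset : Iic γ \ {γ} = Iio γ := Iic_sdiff_right
  rw [hset]
  have hev : ∀ᶠ s in 𝓝[<] γ, s ∈ Ico 0 γ := by
    filter_upwards [Ioo_mem_nhdsLT hγ] with s hs using ⟨hs.1.le, hs.2⟩
  have hlim : Tendsto (fun s => ∫ x, expSlope γ s x ∂μ) (𝓝[<] γ)
      (𝓝 (∫ x, Real.exp (-(γ * x)) * x ∂μ)) := by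
    refine tendsto_integral_filter_of_dominated_convergence
      (fun x => |expSlope γ 0 x| + |Real.exp (-(γ * x)) * x|) ?_ ?_ ?_ ?_
    · exact Eventually.of_forall fun s => by unfold expSlope; fun_prop
    · filter_upwards [hev] with s hs
      refine Eventually.of_forall fun x => ?_
      have h1 := le_expSlope hs.2 x
      have h2 := expSlope_le hs.1 hs.2 x
      rw [Real.norm_eq_abs, abs_le]
      have h3 := neg_abs_le (Real.exp (-(γ * x)) * x)
      have h4 := le_abs_self (expSlope γ 0 x)
      have h5 := abs_nonneg (Real.exp (-(γ * x)) * x)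
      have h6 := abs_nonneg (expSlope γ 0 x)
      constructor <;> linarith
    · exact (hint 0 ⟨le_rfl, hγ⟩).abs.add hI.abs
    · exact Eventually.of_forall fun x => tendsto_expSlope γ x
  refine hlim.neg.congr' ?_
  filter_upwards [hev] with s hs
  have hsf := (lap_lt_top_of_mem_Icc h ⟨hs.1, hs.2.le⟩).ne
  unfold expSlope
  rw [integral_const_mul, integral_sub (integrable_exp_of_lap hsf) (integrable_exp_of_lap h),
    ← toReal_lap, ← toReal_lap, slope_def_field, inv_mul_eq_div, ← neg_sub γ s, div_neg]

theorem integral_nonneg_of_minimizer {μ : Measure ℝ} [IsProbabilityMeasure μ] {γ : ℝ} (hγ : 0 < γ)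
    (h : lap μ γ ≠ ∞) (hmin : ∀ t, 0 ≤ t → lap μ γ ≤ lap μ t) :
    0 ≤ ∫ x, Real.exp (-(γ * x)) * x ∂μ := by
  have hd := hasDerivWithinAt_lap hγ h (integrable_of_minimizer hγ h hmin)
  rw [hasDerivWithinAt_iff_tendsto_slope, Iic_sdiff_right] at hd
  refine neg_nonpos.1 (le_of_tendsto hd ?_)
  filter_upwards [Ioo_mem_nhdsLT hγ] with s hs
  rw [slope_def_field]
  have hsf := (lap_lt_top_of_mem_Icc h ⟨hs.1.le, hs.2.le⟩).ne
  refine div_nonpos_of_nonneg_of_nonpos (sub_nonneg.2 ?_) (by linarith [hs.2])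
  exact ENNReal.toReal_mono hsf (hmin s hs.1.le)

/-! ### Comparison inequalities for the renewal function. -/

theorem iterConv_mul_le (μ : Measure ℝ) [IsProbabilityMeasure μ] (m n : ℕ) (x y : ℝ) :
    iterConv μ m (Iic x) * iterConv μ n (Iic y) ≤ iterConv μ (m + n) (Iic (x + y)) := by
  rw [iterConv_add, Measure.conv, Measure.map_apply measurable_add measurableSet_Iic,
    ← Measure.prod_prod]
  exact measure_mono fun p hp => show p.1 + p.2 ≤ x + y from add_le_add hp.1 hp.2

theorem iterConv_one (μ : Measure ℝ) [IsProbabilityMeasure μ] : iterConv μ 1 = μ := by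
  simp [iterConv]

theorem pow_le_iterConv (μ : Measure ℝ) [IsProbabilityMeasure μ] (n : ℕ) (x : ℝ) :
    μ (Iic x) ^ n ≤ iterConv μ n (Iic (n * x)) := by
  induction n with
  | zero => simp [iterConv]
  | succ n ih =>
    calc _ ≤ iterConv μ n (Iic (n * x)) * iterConv μ 1 (Iic x) := by
          rw [pow_succ, iterConv_one]; gcongr
      _ ≤ _ := by
          refine (iterConv_mul_le μ n 1 _ _).trans_eq ?_
          congr 2
          push_cast; ring

theorem exists_iterConv_pos {μ : Measure ℝ} [IsProbabilityMeasure μ] (h : 0 < μ (Iio 0)) (x : ℝ) :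
    ∃ m, 0 < iterConv μ m (Iic x) := by
  obtain ⟨ε, hε, hp⟩ := exists_pos_measure_Iic_neg h
  obtain ⟨m, hm⟩ := exists_nat_ge (-x / ε)
  refine ⟨m, (ENNReal.pow_pos hp m).trans_le ((pow_le_iterConv μ m _).trans (measure_mono ?_))⟩
  rw [div_le_iff₀ hε] at hm
  exact Iic_subset_Iic.2 (by linarith)

/-- A Harnack-type inequality: spend the first `m` steps getting below `x`, then restart the walk.
-/
theorem mul_renew_le (μ : Measure ℝ) [IsProbabilityMeasure μ] (a : ℝ) (m : ℕ) (x y : ℝ) :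
    ENNReal.ofReal (Real.exp (a * m)) * iterConv μ m (Iic x) * renew μ a y ≤
      renew μ a (x + y) := by
  rw [renew, ← ENNReal.tsum_mul_left]
  calc _ ≤ ∑' n : ℕ, ENNReal.ofReal (Real.exp (a * (m + n : ℕ))) *
        iterConv μ (m + n) (Iic (x + y)) := by
        refine ENNReal.tsum_le_tsum fun n => ?_
        push_cast
        rw [mul_add, Real.exp_add, ENNReal.ofReal_mul (Real.exp_pos _).le]
        refine le_trans (le_of_eq ?_) (mul_le_mul_right (iterConv_mul_le μ m n x y) _)
        ring
    _ ≤ _ := ENNReal.tsum_comp_le_tsum_of_injective (add_right_injective m)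
        (fun n : ℕ => ENNReal.ofReal (Real.exp (a * n)) * iterConv μ n (Iic (x + y)))

theorem renew_pos {μ : Measure ℝ} [IsProbabilityMeasure μ] (h : 0 < μ (Iio 0)) (a x : ℝ) :
    0 < renew μ a x := by
  obtain ⟨m, hm⟩ := exists_iterConv_pos h x
  refine (ENNReal.mul_pos ?_ hm.ne').trans_le (ENNReal.le_tsum m)
  simp [Real.exp_pos]

theorem renew_lt_top_of_lt_top {μ : Measure ℝ} [IsProbabilityMeasure μ] (h : 0 < μ (Iio 0))
    {a x : ℝ} (hx : renew μ a x < ∞) (y : ℝ) : renew μ a y < ∞ := by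
  obtain ⟨m, hm⟩ := exists_iterConv_pos h (x - y)
  have hle := mul_renew_le μ a m (x - y) y
  rw [sub_add_cancel] at hle
  by_contra hc
  rw [not_lt_top_iff.1 hc, ENNReal.mul_top] at hle
  · exact hx.ne (top_le_iff.1 hle)
  · exact mul_ne_zero (by simp [Real.exp_pos]) hm.ne'

theorem renew_mono (μ : Measure ℝ) (a : ℝ) : Monotone (renew μ a) := fun x y hxy =>
  ENNReal.tsum_le_tsum fun n => by gcongr

/-- The renewal function is superharmonic. -/
theorem lintegral_renew_le (μ : Measure ℝ) [IsProbabilityMeasure μ] (a x : ℝ) :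
    ENNReal.ofReal (Real.exp a) * ∫⁻ t, renew μ a (x - t) ∂μ ≤ renew μ a x := by
  have hmeas : ∀ n, Measurable fun t => iterConv μ n (Iic (x - t)) := fun n =>
    Antitone.measurable fun s t hst => measure_mono (Iic_subset_Iic.2 (by linarith))
  have hstep : ∀ n, ∫⁻ t, iterConv μ n (Iic (x - t)) ∂μ = iterConv μ (n + 1) (Iic x) := by
    intro n
    rw [iterConv, Measure.conv_comm, Measure.conv, Measure.map_apply measurable_add measurableSet_Iic,
      Measure.prod_apply (measurable_add measurableSet_Iic)]
    refine lintegral_congr fun t => ?_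
    congr 1
    ext s
    simp [le_sub_iff_add_le']
  simp only [renew]
  rw [lintegral_tsum fun n => ((hmeas n).const_mul _).aemeasurable, ← ENNReal.tsum_mul_left,
    tsum_eq_zero_add' (f := fun n : ℕ => ENNReal.ofReal (Real.exp (a * n)) * iterConv μ n (Iic x))
      ENNReal.summable]
  -- The terms match after a shift of the index; the only loss is the term `n = 0`.
  refine le_trans (ENNReal.tsum_le_tsum fun n => ?_) le_add_self
  rw [lintegral_const_mul _ (hmeas n), hstep, ← mul_assoc, ← ENNReal.ofReal_mul (Real.exp_pos _).le,
    ← Real.exp_add]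
  push_cast
  ring_nf
  exact le_rfl

/-! ### Nonnegative steps and the atom at zero. -/

theorem tendsto_lap_atTop {μ : Measure ℝ} [IsProbabilityMeasure μ] (h : ∀ᵐ x ∂μ, 0 ≤ x) :
    Tendsto (lap μ) atTop (𝓝 (μ {0})) := by
  rw [← lintegral_indicator_one (measurableSet_singleton 0)]
  refine tendsto_lintegral_filter_of_dominated_convergence (fun _ => 1)
    (Eventually.of_forall fun t => by fun_prop) ?_ (by simp) ?_
  · filter_upwards [eventually_ge_atTop 0] with t ht
    filter_upwards [h] with x hx
    exact ENNReal.ofReal_le_one.2 (Real.exp_le_one_iff.2 (by nlinarith))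
  · filter_upwards [h] with x hx
    rcases hx.eq_or_lt with rfl | hx
    · simp
    · rw [indicator_of_notMem (by simpa using hx.ne'), ← ENNReal.ofReal_zero]
      exact ENNReal.tendsto_ofReal (Real.tendsto_exp_neg_atTop_nhds_zero.comp
        (tendsto_id.atTop_mul_const hx))

theorem measure_zero_le_lap (μ : Measure ℝ) (t : ℝ) : μ {0} ≤ lap μ t := by
  rw [← lintegral_indicator_one (measurableSet_singleton 0)]
  refine lintegral_mono fun x => ?_
  by_cases hx : x = 0 <;> simp [hx]

/-- The infimum is a limit as `t → ∞` and need not be attained. -/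
theorem iInf_lap_of_nonneg {μ : Measure ℝ} [IsProbabilityMeasure μ] (h : ∀ᵐ x ∂μ, 0 ≤ x) :
    ⨅ t ∈ Ici (0 : ℝ), lap μ t = μ {0} := by
  refine le_antisymm ?_ (le_iInf₂ fun t _ => measure_zero_le_lap μ t)
  refine ge_of_tendsto (tendsto_lap_atTop h) ?_
  filter_upwards [eventually_ge_atTop 0] with t ht using iInf₂_le t ht

theorem renew_eq_top_of_atom {μ : Measure ℝ} [IsProbabilityMeasure μ] {a x : ℝ}
    (ha : ENNReal.ofReal (Real.exp (-a)) ≤ μ {0}) (hx : 0 ≤ x) : renew μ a x = ∞ := by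
  rw [← top_le_iff, ← ENNReal.tsum_const_eq_top_of_ne_zero (α := ℕ) (one_ne_zero)]
  refine ENNReal.tsum_le_tsum fun n => ?_
  calc (1 : ℝ≥0∞) = ENNReal.ofReal (Real.exp (a * n)) * ENNReal.ofReal (Real.exp (-a)) ^ n := by
        rw [← ENNReal.ofReal_pow (Real.exp_pos _).le, ← ENNReal.ofReal_mul (Real.exp_pos _).le,
          ← Real.exp_nat_mul, ← Real.exp_add]
        ring_nf
        simp
    _ ≤ _ := by
        gcongr
        refine (pow_le_pow_left' (ha.trans (measure_mono ?_)) n).trans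
          ((pow_le_iterConv μ n 0).trans (measure_mono ?_))
        · simp
        · simpa using hx

theorem renew_lt_top_of_iInf_lt {μ : Measure ℝ} [IsProbabilityMeasure μ] {a : ℝ}
    (h : ⨅ t ∈ Ici (0 : ℝ), lap μ t < ENNReal.ofReal (Real.exp (-a))) (x : ℝ) :
    renew μ a x < ∞ := by
  simp only [iInf_lt_iff] at h
  obtain ⟨t, ht, hlt⟩ := h
  exact renew_lt_top_of_lap_lt ht hlt x

/-! ### From superharmonic functions to exponentials. -/

/-- The average over `0 ≤ j < N` of the increments `g (j - k) - g j`. -/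
noncomputable def shiftAvg (g : ℤ → ℝ) (N : ℕ) (k : ℤ) : ℝ :=
  ∑ j ∈ Finset.range N, (N : ℝ)⁻¹ * (g (j - k) - g j)

/-- The sum over `j` telescopes, leaving only boundary terms. -/
theorem shiftAvg_succ (g : ℤ → ℝ) (N : ℕ) (k : ℤ) :
    shiftAvg g N (k + 1) - shiftAvg g N k = (g (-(k + 1)) - g (N + -(k + 1))) / N := by
  rw [shiftAvg, shiftAvg, ← Finset.sum_sub_distrib, div_eq_inv_mul]
  have := Finset.sum_range_sub' (fun j : ℕ => g (j + -(k + 1))) N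
  simp only [Nat.cast_zero, zero_add] at this
  rw [← this, Finset.mul_sum]
  refine Finset.sum_congr rfl fun j _ => ?_
  have h1 : (j : ℤ) - (k + 1) = j + -(k + 1) := by ring
  have h2 : (j : ℤ) - k = ((j + 1 : ℕ) : ℤ) + -(k + 1) := by push_cast; ring
  rw [h1, h2]
  ring

/-- Bounded increments make each boundary term in `shiftAvg_succ` an `O(1/N)` perturbation of `(g 0
- g N)/N`, so the average becomes linear in `k`. -/
theorem tendsto_shiftAvg {g : ℤ → ℝ} {u : ℕ → ℕ} {θ : ℝ} (hu : Tendsto u atTop atTop)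
    (hbdd : ∀ i : ℤ, ∃ C, ∀ j, |g (j + i) - g j| ≤ C)
    (hθ : Tendsto (fun n => (g (u n) - g 0) / u n) atTop (𝓝 θ)) (k : ℤ) :
    Tendsto (fun n => shiftAvg g (u n) k) atTop (𝓝 (-(k * θ))) := by
  have hu' : Tendsto (fun n => (u n : ℝ)) atTop atTop := tendsto_natCast_atTop_atTop.comp hu
  have hinc : ∀ i : ℤ, Tendsto (fun n => (g i - g (u n + i)) / u n) atTop (𝓝 (-θ)) := by
    intro i
    obtain ⟨C, hC⟩ := hbdd i
    have hrem : Tendsto (fun n => (g i - g 0 - (g (u n + i) - g (u n))) / u n) atTop (𝓝 0) := by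
      refine squeeze_zero_norm (a := fun n => (C + C) / u n) (fun n => ?_)
        (tendsto_const_nhds.div_atTop hu')
      rw [norm_div, Real.norm_natCast]
      gcongr
      refine (norm_sub_le _ _).trans (add_le_add ?_ (hC _))
      simpa using hC 0
    refine ((hθ.neg.add hrem).congr fun n => ?_).trans_eq (by rw [add_zero])
    ring
  have hstep : ∀ k : ℤ, Tendsto (fun n => shiftAvg g (u n) (k + 1) - shiftAvg g (u n) k) atTop
      (𝓝 (-θ)) := fun k => by
    simpa only [shiftAvg_succ] using hinc (-(k + 1))
  induction k using Int.induction_on with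
  | zero => simp [shiftAvg]
  | succ i ih =>
    refine ((ih.add (hstep i)).congr fun n => by ring).trans_eq ?_
    congr 1; push_cast; ring
  | pred i ih =>
    have h := hstep (-(i : ℤ) - 1)
    rw [sub_add_cancel] at h
    refine ((ih.sub h).congr fun n => by ring).trans_eq ?_
    congr 1; push_cast; ring

theorem exp_shiftAvg_le (g : ℤ → ℝ) {N : ℕ} (hN : N ≠ 0) (k : ℤ) :
    Real.exp (shiftAvg g N k) ≤
      ∑ j ∈ Finset.range N, (N : ℝ)⁻¹ * Real.exp (g (j - k) - g j) := by
  have := convexOn_exp.map_sum_le (t := Finset.range N) (w := fun _ => (N : ℝ)⁻¹)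
    (p := fun j => g (j - k) - g j) (fun _ _ => by positivity)
    (by simp [mul_inv_cancel₀ (Nat.cast_ne_zero.2 hN : (N : ℝ) ≠ 0)]) (fun _ _ => mem_univ _)
  simpa [shiftAvg] using this

/-- A monotone function `f` with bounded increments such that `e^f` is superharmonic yields
exponential functions that are almost superharmonic. -/
theorem exists_lap_le_of_superharmonic {μ : Measure ℝ} {f : ℝ → ℝ} {K c : ℝ}
    (hmono : Monotone f) (hK : ∀ x, f (x + 1) ≤ f x + K)
    (hf : ∀ x, ∫⁻ t, ENNReal.ofReal (Real.exp (f (x - t) - f x)) ∂μ ≤ ENNReal.ofReal c)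
    {M : ℕ} (hM : M ≠ 0) :
    ∃ θ, 0 ≤ θ ∧ ENNReal.ofReal (Real.exp (-(K / M))) * lap μ θ ≤ ENNReal.ofReal c := by
  have hM0 : (0 : ℝ) < M := by positivity
  have hKn : ∀ (n : ℕ) x, f (x + n) ≤ f x + n * K := by
    intro n x
    induction n with
    | zero => simp
    | succ n ih =>
      have := hK (x + n)
      push_cast
      rw [← add_assoc]
      linarith
  have hK0 : 0 ≤ K := by linarith [hK 0, hmono (show (0 : ℝ) ≤ 0 + 1 by norm_num)]
  set g : ℤ → ℝ := fun j => f (j / M) with hg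
  have hbdd : ∀ i : ℤ, ∃ C, ∀ j, |g (j + i) - g j| ≤ C := by
    intro i
    refine ⟨i.natAbs * K + i.natAbs * K, fun j => ?_⟩
    have hi : |(i : ℝ) / M| ≤ i.natAbs := by
      rw [abs_div, Nat.abs_cast, Nat.cast_natAbs, Int.cast_abs]
      exact div_le_self (abs_nonneg _) (by exact_mod_cast Nat.one_le_iff_ne_zero.2 hM)
    have hi' := abs_le.1 hi
    have h1 : f (j / M + i / M) ≤ f (j / M) + i.natAbs * K :=
      (hmono (by linarith)).trans (hKn i.natAbs _)
    have h2 : f (j / M) ≤ f (j / M + i / M) + i.natAbs * K :=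
      (hmono (by linarith)).trans (hKn i.natAbs _)
    have h3 : (0 : ℝ) ≤ i.natAbs * K := by positivity
    simp only [hg]
    push_cast
    rw [add_div, abs_le]
    constructor <;> linarith
  -- Averaging lengths are multiples of `M`, so `hKn` applies over whole units; compactness then
  -- gives a limiting slope `θ` per mesh step `1/M`.
  have hmem : ∀ n : ℕ, (g ((n + 1) * M : ℕ) - g 0) / ((n + 1) * M : ℕ) ∈ Icc 0 (K / M) := by
    intro n
    have h1 : g ((n + 1) * M : ℕ) = f (0 + (n + 1 : ℕ)) := by
      simp only [hg]; congr 1; push_cast; field_simp; ring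
    have h2 : g 0 = f 0 := by simp [hg]
    rw [h1, h2]
    refine ⟨div_nonneg (sub_nonneg.2 (hmono (by positivity))) (by positivity), ?_⟩
    rw [div_le_div_iff₀ (by positivity) hM0]
    have := hKn (n + 1) 0
    push_cast at this ⊢
    nlinarith
  obtain ⟨θ, hθ, φ, hφ, hlim⟩ := isCompact_Icc.tendsto_subseq hmem
  set u : ℕ → ℕ := fun n => (φ n + 1) * M with hu
  have hutop : Tendsto u atTop atTop :=
    tendsto_atTop_mono (fun n => (Nat.le_succ _).trans (Nat.le_mul_of_pos_right _ (by positivity)))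
      hφ.tendsto_atTop
  have havg := tendsto_shiftAvg hutop hbdd hlim
  -- Per unit length the slope is `θ * M`.
  refine ⟨θ * M, mul_nonneg hθ.1 hM0.le, ?_⟩
  have hmeas : ∀ n, Measurable fun t : ℝ =>
      ENNReal.ofReal (Real.exp (shiftAvg g (u n) ⌈t * M⌉)) := fun n =>
    (measurable_of_countable fun k : ℤ => ENNReal.ofReal (Real.exp (shiftAvg g (u n) k))).comp
      (Int.measurable_ceil.comp (measurable_id.mul_const _))
  have hbound : ∀ n, ∫⁻ t, ENNReal.ofReal (Real.exp (shiftAvg g (u n) ⌈t * M⌉)) ∂μ ≤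
      ENNReal.ofReal c := by
    intro n
    have hun : u n ≠ 0 := by positivity
    have hfm : ∀ j : ℕ, Measurable fun t => ENNReal.ofReal
        (Real.exp (f (j / M - t) - f (j / M))) := fun j => by
      have : Measurable fun t => f (j / M - t) :=
        Antitone.measurable fun s t hst => hmono (by linarith)
      exact (Real.measurable_exp.comp (this.sub_const _)).ennreal_ofReal
    calc _ ≤ ∫⁻ t, ∑ j ∈ Finset.range (u n), ENNReal.ofReal ((u n : ℝ)⁻¹) *
          ENNReal.ofReal (Real.exp (f (j / M - t) - f (j / M))) ∂μ := by
          refine lintegral_mono fun t => ?_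
          simp only [← ENNReal.ofReal_mul (inv_nonneg.2 (Nat.cast_nonneg (α := ℝ) (u n)))]
          rw [← ENNReal.ofReal_sum_of_nonneg fun j _ => by positivity]
          refine ENNReal.ofReal_le_ofReal ((exp_shiftAvg_le g hun _).trans ?_)
          -- Rounding `t` up to the grid only decreases `f (j / M - t)`, by monotonicity.
          gcongr with j hj
          · simp only [hg]
            refine hmono ?_
            push_cast
            rw [sub_div]
            have := Int.le_ceil (t * M)
            have := (le_div_iff₀ hM0).2 this
            linarith
          · simp [hg]
      _ = ∑ j ∈ Finset.range (u n), ENNReal.ofReal ((u n : ℝ)⁻¹) *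
          ∫⁻ t, ENNReal.ofReal (Real.exp (f (j / M - t) - f (j / M))) ∂μ := by
          rw [lintegral_finsetSum _ fun j _ => (hfm j).const_mul _]
          exact Finset.sum_congr rfl fun j _ => lintegral_const_mul _ (hfm j)
      _ ≤ ∑ j ∈ Finset.range (u n), ENNReal.ofReal ((u n : ℝ)⁻¹) * ENNReal.ofReal c := by
          gcongr with j hj
          exact hf _
      _ = ENNReal.ofReal c := by
          rw [Finset.sum_const, Finset.card_range, nsmul_eq_mul, ← mul_assoc,
            ENNReal.ofReal_inv_of_pos (by positivity), ENNReal.ofReal_natCast,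
            ENNReal.mul_inv_cancel (by exact_mod_cast hun) (by simp), one_mul]
  calc _ = ∫⁻ t, ENNReal.ofReal (Real.exp (-(K / M))) *
        ENNReal.ofReal (Real.exp (-(θ * M * t))) ∂μ :=
        (lintegral_const_mul _ (by fun_prop)).symm
    _ ≤ ∫⁻ t, liminf (fun n => ENNReal.ofReal (Real.exp (shiftAvg g (u n) ⌈t * M⌉))) atTop ∂μ := by
        refine lintegral_mono fun t => ?_
        have hlim : Tendsto (fun n => ENNReal.ofReal (Real.exp (shiftAvg g (u n) ⌈t * M⌉))) atTop
            (𝓝 (ENNReal.ofReal (Real.exp (-(⌈t * M⌉ * θ))))) :=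
          ENNReal.tendsto_ofReal ((Real.continuous_exp.tendsto _).comp (havg ⌈t * M⌉))
        rw [hlim.liminf_eq, ← ENNReal.ofReal_mul (by positivity), ← Real.exp_add]
        gcongr
        -- The rounding costs less than one mesh step, hence at most `θ ≤ K / M` in the exponent.
        have := Int.ceil_lt_add_one (t * M)
        nlinarith [hθ.1, hθ.2]
    _ ≤ liminf (fun n => ∫⁻ t, ENNReal.ofReal (Real.exp (shiftAvg g (u n) ⌈t * M⌉)) ∂μ) atTop :=
        lintegral_liminf_le hmeas
    _ ≤ _ := liminf_le_of_le (by isBoundedDefault) fun b hb => by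
        obtain ⟨n, hn⟩ := hb.exists
        exact hn.trans (hbound n)

/-- Apply the preceding theorem to `f = log V`: `lintegral_renew_le` gives superharmonicity,
`mul_renew_le` with a shift of `-1` bounds the increments. The error factor tends to `1` as the mesh
is refined. -/
theorem iInf_lap_le_of_renew_lt_top {μ : Measure ℝ} [IsProbabilityMeasure μ]
    (h : 0 < μ (Iio 0)) {a : ℝ} (hV : ∀ x, renew μ a x < ∞) :
    ⨅ t ∈ Ici (0 : ℝ), lap μ t ≤ ENNReal.ofReal (Real.exp (-a)) := by
  have hpos : ∀ x, 0 < (renew μ a x).toReal := fun x =>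
    ENNReal.toReal_pos (renew_pos h a x).ne' (hV x).ne
  set f : ℝ → ℝ := fun x => Real.log (renew μ a x).toReal with hf
  have hfexp : ∀ x, ENNReal.ofReal (Real.exp (f x)) = renew μ a x := fun x => by
    rw [hf, Real.exp_log (hpos x), ENNReal.ofReal_toReal (hV x).ne]
  have hmono : Monotone f := fun x y hxy =>
    Real.log_le_log (hpos x) (ENNReal.toReal_mono (hV y).ne (renew_mono μ a hxy))
  obtain ⟨m, hm⟩ := exists_iterConv_pos h (-1)
  set c := ENNReal.ofReal (Real.exp (a * m)) * iterConv μ m (Iic (-1)) with hc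
  have hctop : c ≠ ∞ := by finiteness
  have hcpos : 0 < c.toReal :=
    ENNReal.toReal_pos (mul_ne_zero (by simp [Real.exp_pos]) hm.ne') hctop
  have hK : ∀ x, f (x + 1) ≤ f x + -Real.log c.toReal := by
    intro x
    have := mul_renew_le μ a m (-1) (x + 1)
    rw [neg_add_cancel_comm_assoc, ← hc] at this
    have := ENNReal.toReal_mono (hV x).ne this
    rw [ENNReal.toReal_mul] at this
    have := Real.log_le_log (mul_pos hcpos (hpos _)) this
    rw [Real.log_mul hcpos.ne' (hpos _).ne'] at this
    simp only [hf]
    linarith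
  have hsup : ∀ x, ∫⁻ t, ENNReal.ofReal (Real.exp (f (x - t) - f x)) ∂μ ≤
      ENNReal.ofReal (Real.exp (-a)) := by
    intro x
    have hs := lintegral_renew_le μ a x
    have hmeas : Measurable fun t => renew μ a (x - t) :=
      Antitone.measurable fun s t hst => renew_mono μ a (by linarith)
    simp only [sub_eq_add_neg, Real.exp_add]
    simp only [← sub_eq_add_neg, ENNReal.ofReal_mul (Real.exp_pos _).le, hfexp]
    rw [lintegral_mul_const _ hmeas, Real.exp_neg, ENNReal.ofReal_inv_of_pos (Real.exp_pos _), hfexp,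
      ← div_eq_mul_inv, Real.exp_neg, ENNReal.ofReal_inv_of_pos (Real.exp_pos _)]
    refine ENNReal.div_le_of_le_mul ?_
    rw [← ENNReal.div_eq_inv_mul, ENNReal.le_div_iff_mul_le (by simp [Real.exp_pos]) (by simp),
      mul_comm]
    exact hs
  have hM : ∀ M : ℕ, ENNReal.ofReal (Real.exp (-(-Real.log c.toReal / (M + 1 : ℕ)))) *
      (⨅ t ∈ Ici (0 : ℝ), lap μ t) ≤ ENNReal.ofReal (Real.exp (-a)) := by
    intro M
    obtain ⟨θ, hθ, hle⟩ := exists_lap_le_of_superharmonic hmono hK hsup (M.succ_ne_zero)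
    exact le_trans (by gcongr; exact iInf₂_le θ hθ) hle
  have hlim : Tendsto (fun M : ℕ => ENNReal.ofReal (Real.exp (-(-Real.log c.toReal / (M + 1 : ℕ)))) *
      (⨅ t ∈ Ici (0 : ℝ), lap μ t)) atTop
      (𝓝 (ENNReal.ofReal (Real.exp (-0)) * (⨅ t ∈ Ici (0 : ℝ), lap μ t))) := by
    refine ENNReal.Tendsto.mul_const (ENNReal.tendsto_ofReal
      ((Real.continuous_exp.tendsto _).comp (Tendsto.neg ?_))) (Or.inl (by simp))
    exact tendsto_const_nhds.div_atTop
      (tendsto_natCast_atTop_atTop.comp (tendsto_add_atTop_nat 1))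
  have := le_of_tendsto' hlim hM
  simpa using this

/-! ### Transience and recurrence on the canonical space. -/

/-- The random walk on the canonical space of step sequences. -/
noncomputable def coordWalk (n : ℕ) (ω : ℕ → ℝ) : ℝ := walk (fun i (ω : ℕ → ℝ) => ω i) n ω

theorem measurable_coordWalk (n : ℕ) : Measurable (coordWalk n) := by
  unfold coordWalk walk; fun_prop

theorem iIndepFun_coord (ν : Measure ℝ) [IsProbabilityMeasure ν] :
    iIndepFun (fun i (ω : ℕ → ℝ) => ω i) (Measure.infinitePi fun _ : ℕ => ν) :=
  iIndepFun_infinitePi (P := fun _ : ℕ => ν) (X := fun _ x => x) (fun _ => measurable_id)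

theorem map_coordWalk (ν : Measure ℝ) [IsProbabilityMeasure ν] (n : ℕ) :
    (Measure.infinitePi fun _ : ℕ => ν).map (coordWalk n) = iterConv ν n :=
  map_walk (fun i => (measurable_pi_apply i).aemeasurable) (iIndepFun_coord ν)
    (fun i => Measure.infinitePi_map_eval (fun _ : ℕ => ν) i) n

theorem measure_coordWalk (ν : Measure ℝ) [IsProbabilityMeasure ν] (n : ℕ) {B : Set ℝ}
    (hB : MeasurableSet B) :
    (Measure.infinitePi fun _ : ℕ => ν) (coordWalk n ⁻¹' B) = iterConv ν n B := by
  rw [← map_coordWalk, Measure.map_apply (measurable_coordWalk n) hB]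

theorem coordWalk_add (n k : ℕ) (ω : ℕ → ℝ) :
    coordWalk (n + k) ω = coordWalk n ω + coordWalk k (fun i => ω (n + i)) :=
  Finset.sum_range_add _ _ _

/-- The first `n` steps are independent of the later ones, and the shifted sequence has the same
law. -/
theorem measure_coordWalk_inter_shift (ν : Measure ℝ) [IsProbabilityMeasure ν] (n : ℕ) {B : Set ℝ}
    (hB : MeasurableSet B) {E : Set (ℕ → ℝ)} (hE : MeasurableSet E) :
    (Measure.infinitePi fun _ : ℕ => ν) (coordWalk n ⁻¹' B ∩ (fun ω i => ω (n + i)) ⁻¹' E) =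
      iterConv ν n B * (Measure.infinitePi fun _ : ℕ => ν) E := by
  have hind := indep_iSup_of_disjoint
    (m := fun i => MeasurableSpace.comap (fun ω : ℕ → ℝ => ω i) inferInstance)
    (fun i => (measurable_pi_apply i).comap_le) (iIndepFun_coord ν)
    (S := Iio n) (T := Ici n) (Iio_disjoint_Ici le_rfl)
  have hcoord : ∀ (S : Set ℕ), ∀ i ∈ S, Measurable[⨆ i ∈ S,
      MeasurableSpace.comap (fun ω : ℕ → ℝ => ω i) inferInstance] fun ω : ℕ → ℝ => ω i := by
    intro S i hi
    exact (comap_measurable _).mono (le_iSup₂_of_le i hi le_rfl) le_rfl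
  have h1 : MeasurableSet[⨆ i ∈ Iio n, MeasurableSpace.comap (fun ω : ℕ → ℝ => ω i) inferInstance]
      (coordWalk n ⁻¹' B) := by
    have : Measurable[⨆ i ∈ Iio n, MeasurableSpace.comap (fun ω : ℕ → ℝ => ω i) inferInstance]
        (coordWalk n) :=
      Finset.measurable_sum (Finset.range n) fun i hi =>
        hcoord (Iio n) i (by simpa using hi)
    exact this hB
  have h2 : MeasurableSet[⨆ i ∈ Ici n, MeasurableSpace.comap (fun ω : ℕ → ℝ => ω i) inferInstance]
      ((fun (ω : ℕ → ℝ) i => ω (n + i)) ⁻¹' E) := by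
    have : Measurable[⨆ i ∈ Ici n, MeasurableSpace.comap (fun ω : ℕ → ℝ => ω i) inferInstance]
        (fun (ω : ℕ → ℝ) i => ω (n + i)) :=
      @measurable_pi_lambda _ _ _ (_) _ _ fun i => hcoord (Ici n) (n + i) (by simp)
    exact this hE
  rw [(Indep_iff _ _ _).1 hind _ _ h1 h2, measure_coordWalk ν n hB,
    ← Measure.map_apply (by fun_prop) hE,
    Measure.map_infinitePi_infinitePi_of_inj (P := fun _ : ℕ => ν) (add_right_injective n)]

/-- The renewal measure of a walk that eventually leaves `[-1, 1]` is bounded uniformly on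
intervals of length one. -/
theorem exists_renewalMeasure_Icc_le {ν : Measure ℝ} [IsProbabilityMeasure ν]
    (h : ∀ᵐ ω ∂(Measure.infinitePi fun _ : ℕ => ν), ∀ᶠ k in atTop, 1 < |coordWalk k ω|) :
    ∃ C : ℝ≥0∞, C ≠ ∞ ∧ ∀ y, ∑' n, iterConv ν n (Icc y (y + 1)) ≤ C := by
  set W := Measure.infinitePi fun _ : ℕ => ν
  set E : ℕ → Set (ℕ → ℝ) := fun m => {ω | ∀ k ≥ m, 1 < |coordWalk k ω|} with hE
  have hEm : ∀ m, MeasurableSet (E m) := fun m => by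
    simp only [hE, ofPred_forall]
    exact MeasurableSet.iInter fun k => MeasurableSet.iInter fun _ =>
      measurableSet_lt measurable_const (measurable_coordWalk k).abs
  obtain ⟨m, hm⟩ : ∃ m, W (E m) ≠ 0 := by
    by_contra! hc
    have h0 : W (⋃ m, E m) = 0 := measure_iUnion_null hc
    have h1 : ∀ᵐ ω ∂W, False := by
      filter_upwards [h, measure_eq_zero_iff_ae_notMem.1 h0] with ω h1 h2
      exact h2 (mem_iUnion.2 (eventually_atTop.1 h1))
    simpa using h1.exists
  refine ⟨m / W (E m), by finiteness, fun y => ?_⟩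
  rw [ENNReal.le_div_iff_mul_le (Or.inl hm) (Or.inl (by finiteness)), ← ENNReal.tsum_mul_right]
  -- A visit at time `n` after which the walk is more than `1` away from its position at time `n`
  -- from time `n + m` on. After the first such visit, any further one must come within `m` steps,
  -- so at most `m` of them occur.
  set A : ℕ → Set (ℕ → ℝ) := fun n =>
    coordWalk n ⁻¹' Icc y (y + 1) ∩ (fun ω i => ω (n + i)) ⁻¹' E m with hA
  have hAm : ∀ n, MeasurableSet (A n) := fun n =>
    (measurable_coordWalk n measurableSet_Icc).inter
      ((measurable_pi_lambda _ fun i => measurable_pi_apply _) (hEm m))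
  have hcount : ∀ ω, ∑' n, (A n).indicator (1 : (ℕ → ℝ) → ℝ≥0∞) ω ≤ m := by
    intro ω
    by_cases hne : ∃ n, ω ∈ A n
    · classical
      set n₀ := Nat.find hne
      have hn₀ : ω ∈ A n₀ := Nat.find_spec hne
      have hout : ∀ n ∉ Finset.Ico n₀ (n₀ + m), ω ∉ A n := by
        intro n hn hω
        have hle : n₀ ≤ n := Nat.find_min' hne hω
        have hge : n₀ + m ≤ n := by
          by_contra! hlt
          exact hn (Finset.mem_Ico.2 ⟨hle, hlt⟩)
        obtain ⟨k, rfl⟩ := Nat.exists_eq_add_of_le hle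
        have h1 : 1 < |coordWalk k (fun i => ω (n₀ + i))| := hn₀.2 k (by simp; omega)
        have h2 : coordWalk (n₀ + k) ω ∈ Icc y (y + 1) := hω.1
        have h3 : coordWalk n₀ ω ∈ Icc y (y + 1) := hn₀.1
        rw [coordWalk_add] at h2
        refine absurd h1 (not_lt.2 (abs_le.2 ⟨?_, ?_⟩)) <;> linarith [h2.1, h2.2, h3.1, h3.2]
      rw [tsum_eq_sum (s := Finset.Ico n₀ (n₀ + m)) fun n hn => indicator_of_notMem (hout n hn) _]
      calc _ ≤ ∑ n ∈ Finset.Ico n₀ (n₀ + m), (1 : ℝ≥0∞) :=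
            Finset.sum_le_sum fun n _ => by
              rw [indicator_apply]; split_ifs <;> simp
        _ = m := by simp
    · push Not at hne
      simp [hne]
  calc _ = ∑' n, W (A n) :=
        tsum_congr fun n => (measure_coordWalk_inter_shift ν n measurableSet_Icc (hEm m)).symm
    _ = ∫⁻ ω, ∑' n, (A n).indicator (1 : (ℕ → ℝ) → ℝ≥0∞) ω ∂W := by
        rw [lintegral_tsum fun n => (measurable_one.indicator (hAm n)).aemeasurable]
        exact tsum_congr fun n => (lintegral_indicator_one (hAm n)).symm
    _ ≤ ∫⁻ ω, m ∂W := lintegral_mono hcount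
    _ = m := by simp

theorem coordWalk_strong_law {ν : Measure ℝ} [IsProbabilityMeasure ν]
    (hint : Integrable (fun x => x) ν) :
    ∀ᵐ ω ∂(Measure.infinitePi fun _ : ℕ => ν),
      Tendsto (fun n : ℕ => coordWalk n ω / n) atTop (𝓝 (∫ x, x ∂ν)) := by
  have hmp := fun i => measurePreserving_eval_infinitePi (fun _ : ℕ => ν) i
  have := strong_law_ae_real (μ := Measure.infinitePi fun _ : ℕ => ν)
    (fun i (ω : ℕ → ℝ) => ω i) ((hmp 0).integrable_comp_of_integrable hint)
    (fun i j hij => (iIndepFun_coord ν).indepFun hij)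
    (fun i => ⟨(measurable_pi_apply i).aemeasurable, (measurable_pi_apply 0).aemeasurable,
      (hmp i).map_eq.trans (hmp 0).map_eq.symm⟩)
  have hmean : ∫ ω : ℕ → ℝ, ω 0 ∂(Measure.infinitePi fun _ : ℕ => ν) = ∫ x, x ∂ν := by
    calc _ = ∫ x, x ∂((Measure.infinitePi fun _ : ℕ => ν).map (Function.eval 0)) :=
          (integral_map (hmp 0).measurable.aemeasurable (by fun_prop)).symm
      _ = _ := by rw [(hmp 0).map_eq]
  rw [hmean] at this
  exact this

theorem eventually_one_lt_abs_of_pos_drift {ν : Measure ℝ} [IsProbabilityMeasure ν]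
    (hint : Integrable (fun x => x) ν) (hpos : 0 < ∫ x, x ∂ν) :
    ∀ᵐ ω ∂(Measure.infinitePi fun _ : ℕ => ν), ∀ᶠ k in atTop, 1 < |coordWalk k ω| := by
  filter_upwards [coordWalk_strong_law hint] with ω hω
  have h1 : Tendsto (fun n : ℕ => coordWalk n ω / n * n) atTop atTop :=
    hω.pos_mul_atTop hpos tendsto_natCast_atTop_atTop
  filter_upwards [h1.eventually_gt_atTop 1, eventually_gt_atTop 0] with n hn hn0
  rw [div_mul_cancel₀ _ (by positivity)] at hn
  exact hn.trans_le (le_abs_self _)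

/-- Recurrence of centred walks, in the form of Chung and Fuchs. -/
theorem not_eventually_one_lt_abs_of_centred {ν : Measure ℝ} [IsProbabilityMeasure ν]
    (hint : Integrable (fun x => x) ν) (hzero : ∫ x, x ∂ν = 0) :
    ¬ ∀ᵐ ω ∂(Measure.infinitePi fun _ : ℕ => ν), ∀ᶠ k in atTop, 1 < |coordWalk k ω| := by
  intro h
  obtain ⟨C, hC, hbound⟩ := exists_renewalMeasure_Icc_le h
  -- Expected visits to `[-K, K]` are at least `(A K - n₀)/2` by the weak law and at most `2 K C` by
  -- the uniform bound. With `K = n₀ + 1` these conflict once `A > 4C + 1`.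
  obtain ⟨A, hA⟩ := exists_nat_gt (4 * C.toReal + 1)
  have hA0 : (0 : ℝ) < A := lt_of_le_of_lt (by positivity) hA
  have hlaw := coordWalk_strong_law hint
  rw [hzero] at hlaw
  have hprob := tendstoInMeasure_iff_norm.1 (tendstoInMeasure_of_tendsto_ae
    (fun n : ℕ => ((measurable_coordWalk n).div_const _).aestronglyMeasurable) hlaw)
    (A : ℝ)⁻¹ (inv_pos.2 hA0)
  have hhalf : ∀ᶠ n : ℕ in atTop, 2⁻¹ ≤ iterConv ν n (Icc (-(n / A)) (n / A)) := by
    filter_upwards [hprob.eventually (gt_mem_nhds (show (0 : ℝ≥0∞) < 2⁻¹ by simp)),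
      eventually_gt_atTop 0] with n hn hn0
    rw [← measure_coordWalk ν n measurableSet_Icc]
    have hsub : (coordWalk n ⁻¹' Icc (-((n : ℝ) / A)) (n / A))ᶜ ⊆
        {ω | (A : ℝ)⁻¹ ≤ ‖coordWalk n ω / n - 0‖} := by
      intro ω hω
      by_contra hc
      refine hω ?_
      have hc : ‖coordWalk n ω / n - 0‖ < (A : ℝ)⁻¹ := not_le.1 hc
      rw [sub_zero, norm_div, Real.norm_eq_abs, Real.norm_natCast] at hc
      rw [div_lt_iff₀ (by positivity), inv_mul_eq_div] at hc
      exact abs_le.1 hc.le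
    have hle := (measure_mono hsub).trans hn.le
    rw [prob_compl_eq_one_sub (measurable_coordWalk n measurableSet_Icc)] at hle
    rw [tsub_le_iff_right] at hle
    have h2 : (2⁻¹ : ℝ≥0∞) + 2⁻¹ ≤ 2⁻¹ + (Measure.infinitePi fun _ : ℕ => ν)
        (coordWalk n ⁻¹' Icc (-((n : ℝ) / A)) (n / A)) := by rwa [ENNReal.inv_two_add_inv_two]
    exact (ENNReal.add_le_add_iff_left (by simp)).1 h2
  obtain ⟨n₀, hn₀⟩ := eventually_atTop.1 hhalf
  have hlow : ∀ K : ℕ, ((A * K - n₀ : ℕ) : ℝ≥0∞) * 2⁻¹ ≤ ∑' n, iterConv ν n (Icc (-K) K) := by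
    intro K
    calc _ = ∑ n ∈ Finset.Ico n₀ (A * K), (2⁻¹ : ℝ≥0∞) := by simp
      _ ≤ ∑ n ∈ Finset.Ico n₀ (A * K), iterConv ν n (Icc (-K) K) := by
          refine Finset.sum_le_sum fun n hn => (hn₀ n (Finset.mem_Ico.1 hn).1).trans
            (measure_mono ?_)
          have : (n : ℝ) / A ≤ K := by
            rw [div_le_iff₀ hA0, mul_comm]
            exact_mod_cast (Finset.mem_Ico.1 hn).2.le
          exact Icc_subset_Icc (by linarith) this
      _ ≤ _ := ENNReal.sum_le_tsum _
  have hup : ∀ K : ℕ, 1 ≤ K → ∑' n, iterConv ν n (Icc (-K) K) ≤ (2 * K : ℕ) * C := by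
    intro K hK
    calc _ ≤ ∑' n, ∑ j ∈ Finset.range (2 * K), iterConv ν n (Icc (-K + j : ℝ) (-K + j + 1)) := by
          refine ENNReal.tsum_le_tsum fun n => ?_
          refine (measure_mono fun s hs => ?_).trans (measure_biUnion_finset_le _ _)
          have hnn : 0 ≤ s + K := by linarith [hs.1]
          have hle : ⌈s + K⌉₊ ≤ 2 * K := Nat.ceil_le.2 (by push_cast; linarith [hs.2])
          have h1 := Nat.le_ceil (s + K)
          have h2 := Nat.ceil_lt_add_one hnn
          -- At the left endpoint `s = -K` the ceiling is `0`, and truncated subtraction still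
          -- selects the first interval.
          refine mem_iUnion₂.2 ⟨⌈s + K⌉₊ - 1, Finset.mem_range.2 (by omega), ?_⟩
          rcases Nat.eq_zero_or_pos ⌈s + K⌉₊ with h0 | h0
          · rw [h0, Nat.cast_zero] at h1
            rw [h0, Nat.zero_sub, Nat.cast_zero]
            constructor <;> linarith
          · rw [Nat.cast_sub h0, Nat.cast_one]
            constructor <;> linarith
      _ = ∑ j ∈ Finset.range (2 * K), ∑' n, iterConv ν n (Icc (-K + j : ℝ) (-K + j + 1)) :=
          Summable.tsum_finsetSum fun j _ => ENNReal.summable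
      _ ≤ ∑ j ∈ Finset.range (2 * K), C := Finset.sum_le_sum fun j _ => hbound _
      _ = _ := by simp
  have hfin := (hlow (n₀ + 1)).trans (hup (n₀ + 1) (by omega))
  have hreal := ENNReal.toReal_mono (by finiteness) hfin
  have hAn : n₀ ≤ A * (n₀ + 1) := by
    have : 1 ≤ A := by exact_mod_cast hA0
    nlinarith
  simp only [ENNReal.toReal_mul, ENNReal.toReal_natCast, ENNReal.toReal_inv, Nat.cast_sub hAn,
    ENNReal.toReal_ofNat] at hreal
  push_cast at hreal
  have hA1 : (4 * C.toReal + 1) * (n₀ + 1) < A * (n₀ + 1) := by gcongr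
  linarith

/-! ### The critical case: drift of the tilted walk. -/

theorem integrable_tilt {μ : Measure ℝ} [NeZero μ] {γ : ℝ}
    (hI : Integrable (fun x => Real.exp (-(γ * x)) * x) μ) :
    Integrable (fun x => x) (tilt μ γ) := by
  refine Integrable.smul_measure ?_ (ENNReal.inv_ne_top.2 (lap_ne_zero μ γ))
  rw [integrable_withDensity_iff_integrable_smul' (by fun_prop) (by simp)]
  refine hI.congr (Eventually.of_forall fun x => ?_)
  simp [ENNReal.toReal_ofReal (Real.exp_pos _).le]

theorem integral_tilt (μ : Measure ℝ) (γ : ℝ) :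
    ∫ x, x ∂(tilt μ γ) = (lap μ γ).toReal⁻¹ * ∫ x, Real.exp (-(γ * x)) * x ∂μ := by
  rw [tilt, integral_smul_measure, integral_withDensity_eq_integral_toReal_smul (by fun_prop)
    (by simp), ENNReal.toReal_inv, smul_eq_mul]
  congr 1
  refine integral_congr_ae (Eventually.of_forall fun x => ?_)
  simp [ENNReal.toReal_ofReal (Real.exp_pos _).le]

theorem renew_tilt_of_lap_eq {μ : Measure ℝ} [IsProbabilityMeasure μ] {γ a : ℝ}
    (h : lap μ γ = ENNReal.ofReal (Real.exp (-a))) (x : ℝ) :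
    renew μ a x = ∑' n : ℕ,
      ∫⁻ s in Iic x, ENNReal.ofReal (Real.exp (γ * s)) ∂(iterConv (tilt μ γ) n) := by
  rw [renew_tilt (by rw [h]; simp)]
  have : ENNReal.ofReal (Real.exp a) * lap μ γ = 1 := by
    rw [h, ← ENNReal.ofReal_mul (Real.exp_pos _).le, ← Real.exp_add]; simp
  simp [this]

/-- Cut the half-line below `x` into unit intervals: each has renewal mass at most `C`, and the
weights `e^{γ(x-k)}` are summable because `γ > 0`. -/
theorem renew_lt_top_of_pos_drift {μ : Measure ℝ} [IsProbabilityMeasure μ] {γ a : ℝ} (hγ : 0 < γ)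
    (h : lap μ γ = ENNReal.ofReal (Real.exp (-a)))
    (hI : Integrable (fun x => Real.exp (-(γ * x)) * x) μ)
    (hpos : 0 < ∫ x, Real.exp (-(γ * x)) * x ∂μ) (x : ℝ) : renew μ a x < ∞ := by
  have hfin : lap μ γ ≠ ∞ := by rw [h]; simp
  have := tilt_isProbabilityMeasure hfin
  obtain ⟨C, hC, hbound⟩ := exists_renewalMeasure_Icc_le
    (eventually_one_lt_abs_of_pos_drift (integrable_tilt hI) (by
      rw [integral_tilt]
      exact mul_pos (inv_pos.2 (ENNReal.toReal_pos (lap_ne_zero μ γ) hfin)) hpos))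
  rw [renew_tilt_of_lap_eq h]
  set ν := tilt μ γ
  have hcover : Iic x ⊆ ⋃ k : ℕ, Icc (x - k - 1) (x - k - 1 + 1) := by
    intro s hs
    have hnn : 0 ≤ x - s := sub_nonneg.2 hs
    refine mem_iUnion.2 ⟨⌊x - s⌋₊, ?_, ?_⟩
    · linarith [Nat.lt_floor_add_one (x - s)]
    · linarith [Nat.floor_le hnn]
  have hexp : ∀ k : ℕ, ENNReal.ofReal (Real.exp (γ * (x - k))) =
      ENNReal.ofReal (Real.exp (γ * x)) * ENNReal.ofReal (Real.exp (-γ)) ^ k := fun k => by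
    rw [← ENNReal.ofReal_pow (Real.exp_pos _).le, ← ENNReal.ofReal_mul (Real.exp_pos _).le,
      ← Real.exp_nat_mul, ← Real.exp_add]
    ring_nf
  calc _ ≤ ∑' n : ℕ, ∑' k : ℕ, ENNReal.ofReal (Real.exp (γ * (x - k))) *
        iterConv ν n (Icc (x - k - 1) (x - k - 1 + 1)) := by
        refine ENNReal.tsum_le_tsum fun n => ?_
        refine (lintegral_mono_set hcover).trans ((lintegral_iUnion_le _ _).trans ?_)
        refine ENNReal.tsum_le_tsum fun k => ?_
        rw [← setLIntegral_const]
        refine setLIntegral_mono measurable_const fun s hs => ?_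
        gcongr
        linarith [hs.2]
    _ = ∑' k : ℕ, ENNReal.ofReal (Real.exp (γ * (x - k))) *
        ∑' n : ℕ, iterConv ν n (Icc (x - k - 1) (x - k - 1 + 1)) := by
        rw [ENNReal.tsum_comm]
        simp only [ENNReal.tsum_mul_left]
    _ ≤ ∑' k : ℕ, ENNReal.ofReal (Real.exp (γ * (x - k))) * C :=
        ENNReal.tsum_le_tsum fun k => by gcongr; exact hbound _
    _ < ∞ := by
        rw [ENNReal.tsum_mul_right]
        simp only [hexp]
        rw [ENNReal.tsum_mul_left, ENNReal.tsum_geometric]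
        refine ENNReal.mul_lt_top (ENNReal.mul_lt_top (by simp) ?_) hC.lt_top
        simpa using hγ

/-- On `[-1, 1]` the weight `e^{γs}` is at least `e^{-γ}`, so a finite `V(1)` would give finitely
many expected visits there; Borel–Cantelli then contradicts recurrence. -/
theorem renew_eq_top_of_zero_drift {μ : Measure ℝ} [IsProbabilityMeasure μ] {γ a : ℝ}
    (hγ : 0 ≤ γ) (hneg : 0 < μ (Iio 0)) (h : lap μ γ = ENNReal.ofReal (Real.exp (-a)))
    (hI : Integrable (fun x => Real.exp (-(γ * x)) * x) μ)
    (hzero : ∫ x, Real.exp (-(γ * x)) * x ∂μ = 0) (x : ℝ) : renew μ a x = ∞ := by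
  have hfin : lap μ γ ≠ ∞ := by rw [h]; simp
  have := tilt_isProbabilityMeasure hfin
  by_contra hx
  have h1 := renew_lt_top_of_lt_top hneg (lt_top_iff_ne_top.2 hx) 1
  rw [renew_tilt_of_lap_eq h] at h1
  refine not_eventually_one_lt_abs_of_centred (integrable_tilt hI)
    (by rw [integral_tilt, hzero, mul_zero]) ?_
  have hsum : ∑' n, (Measure.infinitePi fun _ : ℕ => tilt μ γ) (coordWalk n ⁻¹' Icc (-1) 1) ≠ ∞ := by
    simp only [measure_coordWalk _ _ measurableSet_Icc]
    have hle : ENNReal.ofReal (Real.exp (-γ)) * ∑' n, iterConv (tilt μ γ) n (Icc (-1) 1) < ∞ := by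
      refine lt_of_le_of_lt ?_ h1
      rw [← ENNReal.tsum_mul_left]
      refine ENNReal.tsum_le_tsum fun n => ?_
      rw [← setLIntegral_const]
      refine le_trans (setLIntegral_mono (by fun_prop) fun s hs => ?_)
        (lintegral_mono_set Icc_subset_Iic_self)
      gcongr
      nlinarith [hs.1]
    intro htop
    rw [htop, ENNReal.mul_top (by simp [Real.exp_pos])] at hle
    exact lt_irrefl _ hle
  filter_upwards [ae_eventually_notMem hsum] with ω hω
  filter_upwards [hω] with n hn
  by_contra hc
  exact hn (abs_le.1 (not_lt.1 hc))

/-! ### Translation to the extended-real rate, and assembly. -/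

theorem expRate_eq {Ω : Type*} [MeasurableSpace Ω] {Q : Measure Ω} {T : Ω → ℝ}
    (hT : AEMeasurable T Q) :
    expRate Q T = -ENNReal.log (⨅ t ∈ Ici (0 : ℝ), lap (Q.map T) t) := by
  simp only [expRate, laplace_eq_lap hT]

theorem coe_lt_neg_log_iff {a : ℝ} {I : ℝ≥0∞} :
    (a : EReal) < -ENNReal.log I ↔ I < ENNReal.ofReal (Real.exp (-a)) := by
  rw [EReal.lt_neg_comm, ← EReal.exp_lt_exp_iff, ENNReal.exp_log, ← EReal.coe_neg, EReal.exp_coe]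

theorem neg_log_lt_coe_iff {a : ℝ} {I : ℝ≥0∞} :
    -ENNReal.log I < (a : EReal) ↔ ENNReal.ofReal (Real.exp (-a)) < I := by
  rw [EReal.neg_lt_comm, ← EReal.exp_lt_exp_iff, ENNReal.exp_log, ← EReal.coe_neg, EReal.exp_coe]

theorem coe_eq_neg_log_iff {a : ℝ} {I : ℝ≥0∞} :
    (a : EReal) = -ENNReal.log I ↔ I = ENNReal.ofReal (Real.exp (-a)) := by
  refine ⟨fun h => le_antisymm ?_ ?_, fun h => le_antisymm ?_ ?_⟩
  · exact not_lt.1 fun hc => (neg_log_lt_coe_iff.2 hc).ne' h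
  · exact not_lt.1 fun hc => (coe_lt_neg_log_iff.2 hc).ne h
  · exact not_lt.1 fun hc => (neg_log_lt_coe_iff.1 hc).ne' h
  · exact not_lt.1 fun hc => (coe_lt_neg_log_iff.1 hc).ne h

end ExpRenewal

theorem theorem2p1 {Ω Ω' : Type*} [MeasurableSpace Ω] [MeasurableSpace Ω']
    (P : Measure Ω) [IsProbabilityMeasure P] (Q : Measure Ω') [IsProbabilityMeasure Q]
    (T : Ω' → ℝ) (X : ℕ → Ω → ℝ)
    (hindep : iIndepFun X P) (hident : ∀ i, IdentDistrib (X i) T P Q)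
    (hnd : Q {ω | T ω = 0} ≠ 1) (a : ℝ) (ha : 0 < a) :
    -- (a)
    (0 < Q {ω | T ω < 0} →
      -- existence and uniqueness of the minimizer `γ₀` of the Laplace transform
      (∃! γ₀ : ℝ, 0 ≤ γ₀ ∧
        ExpRenewal.laplace Q T γ₀ = EReal.exp (-ExpRenewal.expRate Q T)) ∧
      -- (i)
      ((a : EReal) < ExpRenewal.expRate Q T → ∀ x : ℝ, ExpRenewal.expRenewal P X a x < ∞) ∧
      -- (ii) and (iv), with the meaning of `ψ'(γ₀)`
      ((a : EReal) = ExpRenewal.expRate Q T → ∀ γ₀ : ℝ, 0 ≤ γ₀ →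
        ExpRenewal.laplace Q T γ₀ = EReal.exp (-ExpRenewal.expRate Q T) →
        0 < γ₀ ∧ (∀ t ∈ Icc 0 γ₀, ExpRenewal.laplace Q T t < ∞) ∧
        DifferentiableWithinAt ℝ (fun s => (ExpRenewal.laplace Q T s).toReal) (Iic γ₀) γ₀ ∧
        Integrable (fun ω => Real.exp (-(γ₀ * T ω)) * T ω) Q ∧
        -ExpRenewal.laplaceLeftDeriv Q T γ₀ = ∫ ω, Real.exp (-(γ₀ * T ω)) * T ω ∂Q ∧
        (0 < -ExpRenewal.laplaceLeftDeriv Q T γ₀ →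
          ∀ x : ℝ, ExpRenewal.expRenewal P X a x < ∞) ∧
        (ExpRenewal.laplaceLeftDeriv Q T γ₀ = 0 ↔
          ¬ 0 < -ExpRenewal.laplaceLeftDeriv Q T γ₀) ∧
        (ExpRenewal.laplaceLeftDeriv Q T γ₀ = 0 →
          ∀ x : ℝ, ExpRenewal.expRenewal P X a x = ∞)) ∧
      -- (iii)
      (ExpRenewal.expRate Q T < (a : EReal) → ∀ x : ℝ, ExpRenewal.expRenewal P X a x = ∞)) ∧
    -- (b)
    (Q {ω | 0 < T ω} = 1 → ∀ x : ℝ, ExpRenewal.expRenewal P X a x < ∞) ∧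
    -- (c)
    (Q {ω | 0 ≤ T ω} = 1 → 0 < Q {ω | T ω = 0} →
      ExpRenewal.expRate Q T = ((-Real.log (Q.real {ω | T ω = 0}) : ℝ) : EReal) ∧
      ((a : EReal) < ExpRenewal.expRate Q T → ∀ x : ℝ, ExpRenewal.expRenewal P X a x < ∞) ∧
      (ExpRenewal.expRate Q T ≤ (a : EReal) →
        ∀ x : ℝ, 0 ≤ x → ExpRenewal.expRenewal P X a x = ∞)) := by
  have hT : AEMeasurable T Q := (hident 0).aemeasurable_snd
  have hX : ∀ i, AEMeasurable (X i) P := fun i => (hident i).aemeasurable_fst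
  have hmap : ∀ i, P.map (X i) = Q.map T := fun i => (hident i).map_eq
  have hprob : IsProbabilityMeasure (Q.map T) := Measure.isProbabilityMeasure_map hT
  have happ : ∀ {s : Set ℝ}, MeasurableSet s → Q.map T s = Q (T ⁻¹' s) := fun hs =>
    Measure.map_apply_of_aemeasurable hT hs
  have hzero : Q.map T {0} = Q {ω | T ω = 0} := happ (measurableSet_singleton 0)
  have hrate := ExpRenewal.expRate_eq hT
  have hexp : EReal.exp (-ExpRenewal.expRate Q T) =
      ⨅ t ∈ Ici (0 : ℝ), ExpRenewal.lap (Q.map T) t := by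
    rw [hrate, neg_neg, ENNReal.exp_log]
  simp only [ExpRenewal.expRenewal_eq_renew hX hindep hmap, ExpRenewal.laplaceLeftDeriv, hexp,
    ExpRenewal.laplace_eq_lap hT]
  rw [hrate]
  set μ := Q.map T with hμ
  set I := ⨅ t ∈ Ici (0 : ℝ), ExpRenewal.lap μ t with hI
  have hIle : ∀ t, 0 ≤ t → I ≤ ExpRenewal.lap μ t := fun t ht => iInf₂_le t ht
  have hI1 : I ≤ 1 := (hIle 0 le_rfl).trans (ExpRenewal.lap_zero μ).le
  have hItop : I ≠ ∞ := ne_top_of_le_ne_top (by simp) hI1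
  refine ⟨fun hneg => ?_, fun hpos => ?_, fun hnonneg hβ => ?_⟩
  · have hneg' : 0 < μ (Iio 0) := by rw [happ measurableSet_Iio]; exact hneg
    have hnd' : ¬ ∀ᵐ x ∂μ, x = 0 := fun hae => by
      refine hnd (hzero ▸ ?_)
      exact (prob_compl_eq_zero_iff (measurableSet_singleton 0)).1 hae
    refine ⟨?_, fun ha' => ExpRenewal.renew_lt_top_of_iInf_lt (ExpRenewal.coe_lt_neg_log_iff.1 ha'),
      fun ha' γ hγ hmin => ?_, fun ha' x => ?_⟩
    · obtain ⟨γ, hγ, hγI⟩ := ExpRenewal.exists_lap_eq_iInf hneg'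
      refine ⟨γ, ⟨hγ, hγI⟩, fun t ht => ?_⟩
      refine ExpRenewal.lap_minimizer_unique hnd' (ht.2.trans hγI.symm) ?_ ?_
      · rw [ht.2]; exact hItop
      · rw [ht.2]; exact hIle _ (by linarith [ht.1])
    · have hIa := ExpRenewal.coe_eq_neg_log_iff.1 ha'
      -- At `γ = 0` the transform is `1`, whereas the minimum is `e^{-a} < 1`.
      have hγ0 : 0 < γ := by
        refine hγ.lt_of_ne fun h0 => ?_
        rw [← h0, ExpRenewal.lap_zero, hIa] at hmin
        have : ENNReal.ofReal (Real.exp (-a)) < 1 := by simpa using ha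
        exact this.ne' hmin
      have hfin : ExpRenewal.lap μ γ ≠ ∞ := by rw [hmin]; exact hItop
      have hmin' : ∀ t, 0 ≤ t → ExpRenewal.lap μ γ ≤ ExpRenewal.lap μ t := fun t ht => by
        rw [hmin]; exact hIle t ht
      have hint := ExpRenewal.integrable_of_minimizer hγ0 hfin hmin'
      have hderiv := ExpRenewal.hasDerivWithinAt_lap hγ0 hfin hint
      have hnn := ExpRenewal.integral_nonneg_of_minimizer hγ0 hfin hmin'
      rw [hderiv.derivWithin (uniqueDiffWithinAt_Iic γ), neg_neg]
      refine ⟨hγ0, fun t ht => ExpRenewal.lap_lt_top_of_mem_Icc hfin ht,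
        hderiv.differentiableWithinAt, hint.comp_aemeasurable hT,
        integral_map hT hint.aestronglyMeasurable,
        fun hpos => ExpRenewal.renew_lt_top_of_pos_drift hγ0 (hmin.trans hIa) hint hpos, ?_,
        fun h0 => ExpRenewal.renew_eq_top_of_zero_drift hγ hneg' (hmin.trans hIa) hint
          (neg_eq_zero.1 h0)⟩
      rw [neg_eq_zero, not_lt]
      exact ⟨fun h => h.le, fun h => le_antisymm h hnn⟩
    -- Finiteness at a single point spreads to the whole line, as the superharmonic argument
    -- requires.
    · by_contra hx
      have hfin := ExpRenewal.renew_lt_top_of_lt_top hneg' (lt_top_iff_ne_top.2 hx)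
      exact absurd (ExpRenewal.neg_log_lt_coe_iff.1 ha')
        (not_lt.2 (ExpRenewal.iInf_lap_le_of_renew_lt_top hneg' hfin))
  · have hae : ∀ᵐ x ∂μ, 0 < x := by
      refine (prob_compl_eq_zero_iff measurableSet_Ioi).2 ?_
      rw [happ measurableSet_Ioi]; exact hpos
    have hz : μ {0} = 0 := measure_eq_zero_iff_ae_notMem.2 (hae.mono fun x hx h => hx.ne' h)
    refine ExpRenewal.renew_lt_top_of_iInf_lt ?_
    rw [ExpRenewal.iInf_lap_of_nonneg (hae.mono fun x hx => hx.le), hz]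
    simp [Real.exp_pos]
  · have hae : ∀ᵐ x ∂μ, 0 ≤ x := by
      refine (prob_compl_eq_zero_iff measurableSet_Ici).2 ?_
      rw [happ measurableSet_Ici]; exact hnonneg
    have hIβ : I = Q {ω | T ω = 0} := (ExpRenewal.iInf_lap_of_nonneg hae).trans hzero
    refine ⟨?_, fun ha' => ExpRenewal.renew_lt_top_of_iInf_lt (ExpRenewal.coe_lt_neg_log_iff.1 ha'),
      fun ha' x hx => ExpRenewal.renew_eq_top_of_atom ?_ hx⟩
    · rw [hIβ, ENNReal.log_pos_real hβ.ne' (measure_ne_top _ _), EReal.coe_neg]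
      rfl
    · rw [hzero, ← hIβ]
      exact not_lt.1 fun hc => absurd (ExpRenewal.coe_lt_neg_log_iff.2 hc) (not_lt.2 ha')
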